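/- Let $A$ be a finite nonempty set of actions, let $\emptyset\neq X\subseteq\{0,1\}^{A}$ be the set of feasible decisions, and for each $a\in A$ let $S_a=\{z_{a,1},\dots,z_{a,d_a}\}\subset(0,\infty)$ be a set of $d_a\ge 1$ distinct possible values of the random cost $c_a$. Let $\mathcal Q$ be the set of all probability distributions $\mathbb Q$ of the cost vector $\mathbf c=(c_a)_{a\in A}$ on $\prod_a S_a$ (zero probabilities allowed), let $\mathcal Q_a$ be the set of all probability distributions on $S_a$, let $\mathbb Q_a\in\mathcal Q_a$ be the marginals of $\mathbb Q$, write $\mathbf Q=(\mathbb Q_a)_{a\in A}$, and let $f(\mathbf x,\mathbb Q)=\mathbb E_{\mathbb Q}[\mathbf c^\top\mathbf x]$. For sample sizes $\mathbf T=(T_a)_{a\in A}\in\mathbb Z_{>0}^{A}$ put $T_{\min}=\min_a T_a$. For each $a$ one observes $T_a$ i.i.d. samples of $c_a$ with law $\mathbb Q_a$ (the dependence between samples of different actions is arbitrary, but fixed for each $\mathbb Q$ and $\mathbf T$), and $\widehat{\mathbf Q}_{\mathbf T}$ is the vector of the resulting empirical marginal distributions. A prediction rule is a function $\hat f:X\times\prod_a\mathcal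 Q_a\to\mathbb R$, and a prescription rule induced by it is a function $\hat x:\prod_a\mathcal Q_a\to X$ with $\hat x(\mathbf Q)\in\arg\min_{\mathbf x\in X}\hat f(\mathbf x,\mathbf Q)$ for all $\mathbf Q$; both may depend on $\mathbf T$. Fix $r>0$. A pair $(\hat f,\hat x)$, with $\hat x$ induced by $\hat f$, is feasible for the prescription problem $(\mathcal P')$ if $$\limsup_{T_{\min}\to\infty}\frac1{T_{\min}}\ln\Pr\bigl\{f(\hat x(\widehat{\mathbf Q}_{\mathbf T}),\mathbb Q)>\hat f(\hat x(\widehat{\mathbf Q}_{\mathbf T}),\widehat{\mathbf Q}_{\mathbf T})\bigr\}\le -r\qquad\text{for all }\mathbb Q\in\mathcal Q$$ (with $\ln 0=-\infty$). A pair $(\hat f_1,\hat x_1)$ is uniformly less conservative than $(\hat f_2,\hat x_2)$ at $\mathbf T$ if $\hat f_1(\hat x_1(\mathbf Q),\mathbf Q)<\hat f_2(\hat x_2(\mathbf Q),\mathbf Q)$ for all $\mathbb Q\in\mathcal Q$. Let $$r_a=\frac1{T_a}\bigl(\ln|A|+d_a\ln(T_a+1)+T_{\min}r\bigr),\qquad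 a\in A,$$ $$\hat f_{\mathbf r}(\mathbf x,\mathbf Q)=\max\bigl\{\mathbb E_{\mathbb Q'}[\mathbf c^\top\mathbf x]:\ \mathbb Q'\in\mathcal Q,\ D_{KL}(\mathbb Q_a\,\Vert\,\mathbb Q'_a)\le r_a\ \ \forall a\in A\bigr\},$$ where $D_{KL}(p\,\Vert\,q)=\sum_i p_i\ln(p_i/q_i)$ with $0\ln(0/q)=0$ and $p\ln(p/0)=\infty$ for $p>0$, and let $\hat x_{\mathbf r}$ be any prescription rule induced by $\hat f_{\mathbf r}$. **Theorem.** The pair $(\hat f_{\mathbf r},\hat x_{\mathbf r})$ is weakly optimal for $(\mathcal P')$: it is feasible, and no feasible pair is uniformly less conservative than $(\hat f_{\mathbf r},\hat x_{\mathbf r})$, not even merely for a family of sample sizes $\mathbf T$ with unbounded $T_{\min}$. Moreover, no feasible pair that does not depend on $\mathbf T$ is uniformly less conservative than $(\hat f_{\mathbf r},\hat x_{\mathbf r})$ at any single $\mathbf T$. -/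

import Mathlib

open MeasureTheory

noncomputable section

/-- A combinatorial problem with ground set `A`: `supp a` is the finite set of possible values
`z_{a,1}, …, z_{a,d_a}` of the random cost `c_a` (all positive, at least one), and `X` is the
nonempty set of feasible binary decisions. -/
structure CombProblem (A : Type*) where
  supp : A → Finset ℝ
  supp_nonempty : ∀ a, (supp a).Nonempty
  supp_pos : ∀ a, ∀ s ∈ supp a, 0 < s
  X : Set (A → ℝ)
  X_nonempty : X.Nonempty
  X_binary : ∀ x ∈ X, ∀ a, x a = 0 ∨ x a = 1

namespace CombProblem

/-- Cost vectors `c` with `c_a ∈ supp a` for every action `a`. -/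
abbrev Cost {A : Type*} (P : CombProblem A) : Type _ := (a : A) → P.supp a

/-- The set `𝒬` of candidate data-generating distributions: all joint distributions of the cost
vector whose marginals are supported in the sets `supp a`. Zero probabilities are allowed. -/
abbrev Dist {A : Type*} (P : CombProblem A) : Type _ := ProbabilityMeasure P.Cost

/-- `𝒬_1 × ⋯ × 𝒬_m`: vectors of univariate distributions, each given by its probabilities. -/
abbrev Marginals {A : Type*} (P : CombProblem A) : Type _ :=
  (a : A) → stdSimplex ℝ (P.supp a)

/-- The vector of marginals of a joint distribution, `q_{a,s} = Q(c_a = s)`. -/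
def marginals {A : Type*} (P : CombProblem A) (Q : P.Dist) : P.Marginals := fun a =>
  ⟨fun s => (Q : Measure P.Cost).real {c | c a = s}, by
    refine ⟨fun s => measureReal_nonneg, ?_⟩
    have h : ∀ s : P.supp a, MeasurableSet ({c | c a = s} : Set P.Cost) := fun s =>
      (measurableSet_singleton s).preimage (measurable_pi_apply a)
    rw [← measureReal_biUnion_finset (fun s _ t _ hst =>
      Set.disjoint_left.2 fun c hs ht => hst (hs.symm.trans ht)) (fun s _ => h s)]
    have : (⋃ s ∈ (Finset.univ : Finset (P.supp a)), ({c | c a = s} : Set P.Cost))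
        = Set.univ := by
      ext c; simp
    rw [this]
    simp⟩

/-- The nominal expected loss `f(x, Q) = E_Q[cᵀ x]`. -/
def loss {A : Type*} [Fintype A] (P : CombProblem A) (x : P.X) (Q : P.Dist) : ℝ :=
  ∫ c, ∑ a, (c a : ℝ) * x.1 a ∂(Q : Measure P.Cost)

/-- Data sets: `T a` observations of the cost of each action `a`. -/
abbrev Data {A : Type*} (P : CombProblem A) (T : A → ℕ+) : Type _ :=
  (a : A) → Fin (T a) → P.supp a

/-- `L Q T` is an admissible law of the data set with sample sizes `T` under the data-generating
distribution `Q`: for each action `a` the observations of `c_a` are i.i.d. with law the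
`a`-marginal of `Q`. Nothing is required of the dependence between different actions. -/
def IsDataLaw {A : Type*} (P : CombProblem A)
    (L : P.Dist → (T : A → ℕ+) → Measure (P.Data T)) : Prop :=
  ∀ (Q : P.Dist) (T : A → ℕ+) (a : A),
    (L Q T).map (fun C => C a) =
      Measure.pi fun _ : Fin (T a) => (Q : Measure P.Cost).map fun c => c a

/-- The vector of empirical marginal distributions of a data set. -/
def empirical {A : Type*} (P : CombProblem A) {T : A → ℕ+} (C : P.Data T) : P.Marginals :=
  fun a => ⟨fun s => (1 / (T a : ℝ)) * ∑ j, if C a j = s then (1 : ℝ) else 0, by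
    refine ⟨fun s => mul_nonneg (by positivity)
      (Finset.sum_nonneg fun j _ => by split_ifs <;> norm_num), ?_⟩
    rw [← Finset.mul_sum, Finset.sum_comm]
    simp⟩

/-- A prediction rule (for given sample sizes). -/
abbrev Predictor {A : Type*} (P : CombProblem A) : Type _ := P.X → P.Marginals → ℝ

/-- A map from vectors of marginals to feasible decisions. -/
abbrev Prescriptor {A : Type*} (P : CombProblem A) : Type _ := P.Marginals → P.X

/-- `x` is a prescription rule induced by the prediction rule `f`. -/
def IsPrescription {A : Type*} (P : CombProblem A) (f : P.Predictor) (x : P.Prescriptor) : Prop :=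
  ∀ q : P.Marginals, ∀ y : P.X, f (x q) q ≤ f y q

/-- The minimal sample size. -/
def Tmin {A : Type*} [Fintype A] [Nonempty A] (T : A → ℕ+) : ℕ+ :=
  Finset.univ.inf' Finset.univ_nonempty T

/-- The limit regime `T_min → ∞`. -/
def largeSamples (A : Type*) [Fintype A] [Nonempty A] : Filter (A → ℕ+) :=
  Filter.comap Tmin Filter.atTop

/-- The out-of-sample prescription disappointment `Pr{f(x̂(Q̂_T), Q) > f̂(x̂(Q̂_T), Q̂_T)}`. -/
def disappointment {A : Type*} [Fintype A] (P : CombProblem A)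
    (L : P.Dist → (T : A → ℕ+) → Measure (P.Data T))
    (f : P.Predictor) (x : P.Prescriptor) (Q : P.Dist) (T : A → ℕ+) : ENNReal :=
  L Q T {C | P.loss (x (P.empirical C)) Q > f (x (P.empirical C)) (P.empirical C)}

/-- Feasibility in the prescription problem with decay rate `r`. The pair may depend on the sample
sizes. The logarithm takes values in the extended reals, with `ln 0 = -∞`. -/
def Feasible {A : Type*} [Fintype A] [Nonempty A] (P : CombProblem A)
    (L : P.Dist → (T : A → ℕ+) → Measure (P.Data T)) (r : ℝ)
    (f : (A → ℕ+) → P.Predictor) (x : (A → ℕ+) → P.Prescriptor) : Prop :=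
  (∀ T, P.IsPrescription (f T) (x T)) ∧
  ∀ Q : P.Dist,
    Filter.limsup (fun T : A → ℕ+ => ((1 / (Tmin T : ℝ) : ℝ) : EReal) *
        ENNReal.log (P.disappointment L (f T) (x T) Q T)) (largeSamples A)
      ≤ ((-r : ℝ) : EReal)

/-- `(f₁, x₁)` is less conservative than `(f₂, x₂)` uniformly over all distributions. -/
def LessConservative {A : Type*} (P : CombProblem A)
    (f₁ : P.Predictor) (x₁ : P.Prescriptor) (f₂ : P.Predictor) (x₂ : P.Prescriptor) : Prop :=
  ∀ Q : P.Dist, f₁ (x₁ (P.marginals Q)) (P.marginals Q) < f₂ (x₂ (P.marginals Q)) (P.marginals Q)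

/-- Weak optimality for the prescription problem: the pair is feasible, and no feasible pair is
uniformly less conservative, be it only for a collection of sample sizes with unbounded `T_min`. -/
def WeaklyOptimal {A : Type*} [Fintype A] [Nonempty A] (P : CombProblem A)
    (L : P.Dist → (T : A → ℕ+) → Measure (P.Data T)) (r : ℝ)
    (f : (A → ℕ+) → P.Predictor) (x : (A → ℕ+) → P.Prescriptor) : Prop :=
  P.Feasible L r f x ∧
  ¬ ∃ (g : (A → ℕ+) → P.Predictor) (y : (A → ℕ+) → P.Prescriptor), P.Feasible L r g y ∧
    ∃ᶠ T in largeSamples A, P.LessConservative (g T) (y T) (f T) (x T)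

/-- A term `p ln (p / q)` of the relative entropy, with `0 ln (0 / q) = 0` and
`p ln (p / 0) = ∞` for `p > 0`. -/
def klTerm (p q : ℝ) : EReal :=
  if p = 0 then 0 else if q = 0 then ⊤ else ((p * Real.log (p / q) : ℝ) : EReal)

/-- Relative entropy of two distributions on a finite set. -/
def relEntropy {S : Type*} [Fintype S] (p q : stdSimplex ℝ S) : EReal :=
  ∑ s, klTerm (p.1 s) (q.1 s)

/-- The radius `r_a = (ln |A| + d_a ln (T_a + 1) + T_min r) / T_a`, with `d_a = |supp a|`. -/
def radius {A : Type*} [Fintype A] [Nonempty A] (P : CombProblem A) (r : ℝ) (T : A → ℕ+)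
    (a : A) : ℝ :=
  (1 / (T a : ℝ)) * (Real.log (Fintype.card A) + ((P.supp a).card : ℝ) * Real.log ((T a : ℝ) + 1)
    + (Tmin T : ℝ) * r)

/-- Joint distributions whose marginals lie in the relative entropy balls of radii `ρ a` around
the components of `q`. -/
def ambiguitySet {A : Type*} (P : CombProblem A) (ρ : A → ℝ) (q : P.Marginals) : Set P.Dist :=
  {Q | ∀ a, relEntropy (q a) (P.marginals Q a) ≤ (ρ a : EReal)}

/-- The distributionally robust prediction rule: the worst-case expected loss. -/
def robustPredictor {A : Type*} [Fintype A] (P : CombProblem A) (ρ : A → ℝ) : P.Predictor :=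
  fun x q => sSup ((fun Q => P.loss x Q) '' P.ambiguitySet ρ q)

end CombProblem

end

open MeasureTheory Filter

/-! ### The method of types -/

section Types

variable {S : Type*} [Fintype S] [DecidableEq S]

/-- The number of occurrences of each symbol in a word of length `T`. -/
def wordType {T : ℕ} (w : Fin T → S) : S → Fin (T + 1) := fun s =>
  ⟨(Finset.univ.filter fun j => w j = s).card,
    Nat.lt_succ_of_le ((Finset.card_filter_le _ _).trans (by simp))⟩

lemma sum_wordType {T : ℕ} (w : Fin T → S) : ∑ s, ((wordType w s : ℕ) : ℝ) = T := by
  have h := Finset.card_eq_sum_card_fiberwise (s := (Finset.univ : Finset (Fin T)))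
    (t := (Finset.univ : Finset S)) (f := w) (by simp [Set.MapsTo])
  rw [Finset.card_univ, Fintype.card_fin] at h
  exact_mod_cast h.symm

/-- The probability of a whole type class under its own empirical distribution is at most one. -/
lemma sum_prod_wordType_le_one {T : ℕ} (hT : 0 < T) (n : S → Fin (T + 1)) :
    ∑ w : Fin T → S with wordType w = n, ∏ j, ((n (w j) : ℕ) / (T : ℝ)) ≤ 1 := by
  by_cases hn : ∃ w : Fin T → S, wordType w = n
  · obtain ⟨w₀, rfl⟩ := hn
    have hT' : (T : ℝ) ≠ 0 := by positivity
    calc _ ≤ ∑ w : Fin T → S, ∏ j, ((wordType w₀ (w j) : ℕ) / (T : ℝ)) :=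
          Finset.sum_le_sum_of_subset_of_nonneg (Finset.filter_subset _ _)
            fun _ _ _ => by positivity
      _ = ∏ _j : Fin T, ∑ s, ((wordType w₀ s : ℕ) / (T : ℝ)) :=
          (Fintype.prod_sum fun (_ : Fin T) (s : S) => ((wordType w₀ s : ℕ) / (T : ℝ))).symm
      _ = 1 := by
          rw [← Finset.sum_div, sum_wordType, div_self hT']
          simp
      _ ≤ 1 := le_rfl
  · rw [Finset.filter_false_of_mem fun w _ h => hn ⟨w, h⟩]
    simp

lemma sum_prod_ownType_le {T : ℕ} (hT : 0 < T) :
    ∑ w : Fin T → S, ∏ j, ((wordType w (w j) : ℕ) / (T : ℝ))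
      ≤ ((T : ℝ) + 1) ^ Fintype.card S := by
  rw [← Finset.sum_fiberwise Finset.univ (wordType (S := S) (T := T))]
  calc _ = ∑ n : S → Fin (T + 1), ∑ w : Fin T → S with wordType w = n,
        ∏ j, ((n (w j) : ℕ) / (T : ℝ)) := by
        refine Finset.sum_congr rfl fun n _ => Finset.sum_congr rfl fun w hw => ?_
        rw [(Finset.mem_filter.1 hw).2]
    _ ≤ ∑ _n : S → Fin (T + 1), (1 : ℝ) :=
        Finset.sum_le_sum fun n _ => sum_prod_wordType_le_one hT n
    _ = _ := by simp

lemma prod_word_eq {T : ℕ} (w : Fin T → S) (g : S → ℝ) :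
    ∏ j, g (w j) = ∏ s, g s ^ (wordType w s : ℕ) := by
  rw [← Finset.prod_fiberwise Finset.univ w]
  refine Finset.prod_congr rfl fun s _ => ?_
  rw [Finset.prod_congr rfl fun j hj => by rw [(Finset.mem_filter.1 hj).2], Finset.prod_const]
  rfl

lemma coe_sum_eReal {ι : Type*} (s : Finset ι) (f : ι → ℝ) :
    ((∑ i ∈ s, f i : ℝ) : EReal) = ∑ i ∈ s, (f i : EReal) :=
  map_sum (⟨⟨((↑) : ℝ → EReal), rfl⟩, EReal.coe_add⟩ : ℝ →+ EReal) f s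

/-- A word whose empirical distribution is at relative entropy more than `ρ` from `q` is
exponentially less likely under `q` than under its empirical distribution. -/
lemma prod_le_exp_mul_prod_ownType {T : ℕ} (hT : 0 < T) (w : Fin T → S)
    (p q : stdSimplex ℝ S) (hp : ∀ s, p.1 s = (wordType w s : ℕ) / (T : ℝ)) {ρ : ℝ}
    (h : (ρ : EReal) < CombProblem.relEntropy p q) :
    ∏ j, q.1 (w j) ≤ Real.exp (-(T * ρ)) * ∏ j, ((wordType w (w j) : ℕ) / (T : ℝ)) := by
  have hT' : (0 : ℝ) < T := by positivity
  have hpos : 0 ≤ Real.exp (-(T * ρ)) * ∏ j, ((wordType w (w j) : ℕ) / (T : ℝ)) := by positivity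
  by_cases hz : ∃ j, q.1 (w j) = 0
  · obtain ⟨j, hj⟩ := hz
    rwa [Finset.prod_eq_zero (Finset.mem_univ j) hj]
  push Not at hz
  have hq : ∀ s, p.1 s ≠ 0 → 0 < q.1 s := by
    intro s hs
    have : (wordType w s : ℕ) ≠ 0 := fun h0 => hs (by rw [hp, h0]; simp)
    obtain ⟨j, hj⟩ : (Finset.univ.filter fun j => w j = s).Nonempty :=
      Finset.card_pos.1 (Nat.pos_of_ne_zero this)
    rw [← (Finset.mem_filter.1 hj).2]
    exact lt_of_le_of_ne (q.2.1 _) (hz j).symm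
  have hterm : ∀ s, CombProblem.klTerm (p.1 s) (q.1 s)
      = ((p.1 s * Real.log (p.1 s / q.1 s) : ℝ) : EReal) := by
    intro s
    unfold CombProblem.klTerm
    split_ifs with h1 h2
    · simp [h1]
    · exact absurd h2 (hq s h1).ne'
    · rfl
  have hD : ρ < ∑ s, p.1 s * Real.log (p.1 s / q.1 s) := by
    unfold CombProblem.relEntropy at h
    rw [Finset.sum_congr rfl fun s _ => hterm s, ← coe_sum_eReal] at h
    exact_mod_cast h
  have hkey : ∏ j, q.1 (w j) = Real.exp (-(T * ∑ s, p.1 s * Real.log (p.1 s / q.1 s)))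
      * ∏ j, p.1 (w j) := by
    rw [prod_word_eq, prod_word_eq w p.1, Finset.mul_sum, ← Finset.sum_neg_distrib,
      Real.exp_sum, ← Finset.prod_mul_distrib]
    refine Finset.prod_congr rfl fun s _ => ?_
    by_cases hs : p.1 s = 0
    · have : (wordType w s : ℕ) = 0 := by
        have h0 := hp s
        rw [hs, eq_comm, div_eq_zero_iff] at h0
        exact_mod_cast h0.resolve_right hT'.ne'
      simp [hs, this]
    · have hps : 0 < p.1 s := lt_of_le_of_ne (p.2.1 s) (Ne.symm hs)
      have hn : (T : ℝ) * p.1 s = (wordType w s : ℕ) := by rw [hp]; field_simp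
      rw [← mul_assoc, hn, ← mul_neg, ← Real.log_inv, inv_div, Real.exp_nat_mul,
        Real.exp_log (div_pos (hq s hs) hps), ← mul_pow, div_mul_cancel₀ _ hs]
  rw [hkey, Finset.prod_congr rfl fun j _ => hp (w j)]
  gcongr

/-- The upper bound in Sanov's theorem on a finite alphabet. -/
lemma pi_relEntropy_gt_le [MeasurableSpace S] [MeasurableSingletonClass S]
    (μ : Measure S) [IsProbabilityMeasure μ] {T : ℕ} (hT : 0 < T) (q : stdSimplex ℝ S)
    (hq : ∀ s, q.1 s = μ.real {s}) (p : (Fin T → S) → stdSimplex ℝ S)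
    (hp : ∀ w s, (p w).1 s = (wordType w s : ℕ) / (T : ℝ)) (ρ : ℝ) :
    (Measure.pi fun _ : Fin T => μ) {w | (ρ : EReal) < CombProblem.relEntropy (p w) q}
      ≤ ENNReal.ofReal (((T : ℝ) + 1) ^ Fintype.card S * Real.exp (-(T * ρ))) := by
  classical
  set B : Set (Fin T → S) := {w | (ρ : EReal) < CombProblem.relEntropy (p w) q} with hB
  rw [← ofReal_measureReal]
  refine ENNReal.ofReal_le_ofReal ?_
  have hB' : B = ((Finset.univ.filter (· ∈ B) : Finset (Fin T → S)) : Set (Fin T → S)) := by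
    ext; simp
  rw [hB', ← sum_measureReal_singleton]
  calc _ = ∑ w : Fin T → S with w ∈ B, ∏ j, q.1 (w j) := by
        refine Finset.sum_congr rfl fun w _ => ?_
        rw [measureReal_def, Measure.pi_singleton, ENNReal.toReal_prod]
        exact Finset.prod_congr rfl fun j _ => (hq _).symm
    _ ≤ ∑ w : Fin T → S with w ∈ B,
          Real.exp (-(T * ρ)) * ∏ j, ((wordType w (w j) : ℕ) / (T : ℝ)) :=
        Finset.sum_le_sum fun w hw =>
          prod_le_exp_mul_prod_ownType hT w (p w) q (hp w) (Finset.mem_filter.1 hw).2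
    _ ≤ ∑ w : Fin T → S,
          Real.exp (-(T * ρ)) * ∏ j, ((wordType w (w j) : ℕ) / (T : ℝ)) :=
        Finset.sum_le_sum_of_subset_of_nonneg (Finset.filter_subset _ _)
          fun _ _ _ => by positivity
    _ ≤ _ := by
        rw [← Finset.mul_sum, mul_comm]
        gcongr
        exact sum_prod_ownType_le hT

end Types

namespace CombProblem

lemma relEntropy_self {S : Type*} [Fintype S] (p : stdSimplex ℝ S) : relEntropy p p = 0 :=
  Finset.sum_eq_zero fun s _ => by
    unfold klTerm
    split_ifs with h
    · rfl
    · simp [h]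

variable {A : Type*} (P : CombProblem A)

/-! ### The point mass at the largest costs -/

/-- The cost vector all of whose entries are maximal. -/
noncomputable def maxCost : P.Cost :=
  fun a => ⟨(P.supp a).max' (P.supp_nonempty a), Finset.max'_mem _ _⟩

lemma le_maxCost (c : P.Cost) (a : A) : (c a : ℝ) ≤ P.maxCost a :=
  Finset.le_max' _ _ (c a).2

/-- The distribution under which every cost is maximal. -/
noncomputable def maxDist : P.Dist := ⟨Measure.dirac P.maxCost, inferInstance⟩

lemma X_nonneg (x : P.X) (a : A) : 0 ≤ x.1 a := by
  rcases P.X_binary x.1 x.2 a with h | h <;> simp [h]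

lemma map_eval_maxDist (a : A) :
    (P.maxDist : Measure P.Cost).map (fun c => c a) = Measure.dirac (P.maxCost a) :=
  Measure.map_dirac' (measurable_pi_apply a) _

lemma marginals_apply (Q : P.Dist) (a : A) (s : P.supp a) :
    (P.marginals Q a).1 s = ((Q : Measure P.Cost).map fun c => c a).real {s} := by
  rw [map_measureReal_apply (measurable_pi_apply a) (measurableSet_singleton s)]
  rfl

lemma empirical_apply {T : A → ℕ+} (C : P.Data T) (a : A) (s : P.supp a) :
    (P.empirical C a).1 s = (wordType (C a) s : ℕ) / (T a : ℝ) := by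
  simp [empirical, wordType, Finset.sum_boole, div_eq_inv_mul]

lemma empirical_maxCost (T : A → ℕ+) :
    P.empirical (T := T) (fun a _ => P.maxCost a) = P.marginals P.maxDist := by
  funext a
  ext s
  change _ = (P.marginals P.maxDist a).1 s
  rw [marginals_apply, map_eval_maxDist]
  change (1 / (T a : ℝ)) * ∑ j : Fin (T a), (if P.maxCost a = s then (1 : ℝ) else 0) = _
  by_cases h : P.maxCost a = s
  · simp [h, measureReal_def]
  · simp [h, measureReal_def]

lemma mem_ambiguitySet_marginals {ρ : A → ℝ} (hρ : ∀ a, 0 ≤ ρ a) (Q : P.Dist) :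
    Q ∈ P.ambiguitySet ρ (P.marginals Q) := fun a => by
  rw [relEntropy_self]
  exact_mod_cast hρ a

lemma IsDataLaw.isProbabilityMeasure {P : CombProblem A}
    {L : P.Dist → (T : A → ℕ+) → Measure (P.Data T)} [Nonempty A] (hL : P.IsDataLaw L) (Q : P.Dist)
    (T : A → ℕ+) : IsProbabilityMeasure (L Q T) := by
  obtain ⟨a⟩ := ‹Nonempty A›
  have := Measure.isProbabilityMeasure_map (μ := (Q : Measure P.Cost))
    (measurable_pi_apply a).aemeasurable
  have h : IsProbabilityMeasure ((L Q T).map fun C => C a) := by rw [hL Q T a]; infer_instance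
  exact Measure.isProbabilityMeasure_of_map (fun C : P.Data T => C a)

lemma IsDataLaw.relEntropy_gt_le {P : CombProblem A}
    {L : P.Dist → (T : A → ℕ+) → Measure (P.Data T)}
    (hL : P.IsDataLaw L) (Q : P.Dist) (T : A → ℕ+) (a : A) (ρ : ℝ) :
    L Q T {C | (ρ : EReal) < relEntropy (P.empirical C a) (P.marginals Q a)}
      ≤ ENNReal.ofReal (((T a : ℝ) + 1) ^ (P.supp a).card * Real.exp (-(T a * ρ))) := by
  have := Measure.isProbabilityMeasure_map (μ := (Q : Measure P.Cost))
    (measurable_pi_apply a).aemeasurable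
  let p : (Fin (T a) → P.supp a) → stdSimplex ℝ (P.supp a) := fun w =>
    ⟨fun s => (wordType w s : ℕ) / (T a : ℝ), fun s => by positivity, by
      rw [← Finset.sum_div]
      exact (div_eq_one_iff_eq (by positivity)).2 (sum_wordType w)⟩
  have hp : ∀ C : P.Data T, P.empirical C a = p (C a) := fun C =>
    Subtype.ext (funext fun s => P.empirical_apply C a s)
  have h := pi_relEntropy_gt_le ((Q : Measure P.Cost).map fun c => c a) (T a).pos
    (P.marginals Q a) (P.marginals_apply Q a) p (fun _ _ => rfl) ρ
  rw [← hL Q T a, Measure.map_apply (measurable_pi_apply a) (Set.toFinite _).measurableSet,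
    Fintype.card_coe] at h
  simpa only [hp, Set.preimage_ofPred_eq] using h

variable [Fintype A]

lemma loss_maxDist (x : P.X) : P.loss x P.maxDist = ∑ a, (P.maxCost a : ℝ) * x.1 a :=
  integral_dirac _ _

lemma loss_le_maxDist (x : P.X) (Q : P.Dist) : P.loss x Q ≤ P.loss x P.maxDist := by
  rw [loss_maxDist]
  calc P.loss x Q ≤ ∫ _, ∑ a, (P.maxCost a : ℝ) * x.1 a ∂(Q : Measure P.Cost) := by
        refine integral_mono (.of_finite) (integrable_const _) fun c => ?_
        exact Finset.sum_le_sum fun a _ =>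
          mul_le_mul_of_nonneg_right (P.le_maxCost c a) (P.X_nonneg x a)
    _ = _ := by simp

lemma bddAbove_loss_image (x : P.X) (B : Set P.Dist) :
    BddAbove ((fun Q => P.loss x Q) '' B) :=
  ⟨P.loss x P.maxDist, by rintro _ ⟨Q, -, rfl⟩; exact P.loss_le_maxDist x Q⟩

lemma loss_le_robustPredictor {ρ : A → ℝ} {q : P.Marginals} {Q : P.Dist}
    (hQ : Q ∈ P.ambiguitySet ρ q) (x : P.X) : P.loss x Q ≤ P.robustPredictor ρ x q :=
  le_csSup (P.bddAbove_loss_image x _) ⟨Q, hQ, rfl⟩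

lemma robustPredictor_maxDist {ρ : A → ℝ} (hρ : ∀ a, 0 ≤ ρ a) (x : P.X) :
    P.robustPredictor ρ x (P.marginals P.maxDist) = P.loss x P.maxDist := by
  refine le_antisymm (csSup_le ⟨_, P.maxDist, P.mem_ambiguitySet_marginals hρ _, rfl⟩ ?_)
    (P.loss_le_robustPredictor (P.mem_ambiguitySet_marginals hρ _) x)
  rintro _ ⟨Q, -, rfl⟩
  exact P.loss_le_maxDist x Q

variable {P}

/-- A rule that covers the loss at the point mass of maximal costs is not uniformly less
conservative than the robust one. -/
lemma not_lessConservative_robust {ρ : A → ℝ} (hρ : ∀ a, 0 ≤ ρ a) {x : P.Prescriptor}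
    (hx : P.IsPrescription (P.robustPredictor ρ) x) {g : P.Predictor} {y : P.Prescriptor}
    (h : P.loss (y (P.marginals P.maxDist)) P.maxDist
      ≤ g (y (P.marginals P.maxDist)) (P.marginals P.maxDist)) :
    ¬ P.LessConservative g y (P.robustPredictor ρ) x := fun hlt =>
  (hlt P.maxDist).not_ge <| calc
    _ ≤ P.robustPredictor ρ (y (P.marginals P.maxDist)) (P.marginals P.maxDist) := hx _ _
    _ = P.loss (y (P.marginals P.maxDist)) P.maxDist := P.robustPredictor_maxDist hρ _
    _ ≤ _ := h

/-! ### Laws of the data -/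

variable {L : P.Dist → (T : A → ℕ+) → Measure (P.Data T)}

lemma IsDataLaw.ae_eq_maxCost (hL : P.IsDataLaw L) (T : A → ℕ+) :
    ∀ᵐ C ∂L P.maxDist T, C = fun a _ => P.maxCost a := by
  have h : ∀ a, ∀ᵐ C ∂L P.maxDist T, C a = fun _ => P.maxCost a := by
    intro a
    refine ae_of_ae_map (f := fun C : P.Data T => C a) (measurable_pi_apply a).aemeasurable
      (p := fun w : Fin (T a) → P.supp a => w = fun _ => P.maxCost a) ?_
    rw [hL, map_eval_maxDist]
    rw [ae_iff, ← Set.compl_ofPred, prob_compl_eq_zero_iff (by measurability)]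
    simp [Measure.pi_singleton]
  filter_upwards [ae_all_iff.2 h] with C hC using funext hC

variable [Nonempty A]

/-- When the costs are deterministic, so is the disappointment. -/
lemma IsDataLaw.disappointment_maxDist (hL : P.IsDataLaw L) (T : A → ℕ+) (f : P.Predictor)
    (x : P.Prescriptor)
    (h : f (x (P.marginals P.maxDist)) (P.marginals P.maxDist)
      < P.loss (x (P.marginals P.maxDist)) P.maxDist) :
    P.disappointment L f x P.maxDist T = 1 := by
  have := hL.isProbabilityMeasure P.maxDist T
  rw [disappointment, ← measure_univ (μ := L P.maxDist T)]
  refine measure_congr (eventuallyEq_univ.2 ?_)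
  filter_upwards [hL.ae_eq_maxCost T] with C hC
  rw [hC, empirical_maxCost]
  exact h

lemma Feasible.eventually_loss_maxDist_le (hL : P.IsDataLaw L) {r : ℝ} (hr : 0 < r)
    {f : (A → ℕ+) → P.Predictor} {x : (A → ℕ+) → P.Prescriptor} (h : P.Feasible L r f x) :
    ∀ᶠ T in largeSamples A, P.loss (x T (P.marginals P.maxDist)) P.maxDist
      ≤ f T (x T (P.marginals P.maxDist)) (P.marginals P.maxDist) := by
  have hlt := (h.2 P.maxDist).trans_lt
    (show ((-r : ℝ) : EReal) < 0 by exact_mod_cast neg_neg_of_pos hr)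
  filter_upwards [eventually_lt_of_limsup_lt hlt] with T hT
  by_contra! hcon
  rw [hL.disappointment_maxDist T _ _ hcon] at hT
  simp at hT

lemma largeSamples_neBot : (largeSamples A).NeBot := by
  refine comap_neBot fun t ht => ?_
  obtain ⟨n, hn⟩ := (nonempty_of_mem ht)
  exact ⟨fun _ => n, by simpa [Tmin] using hn⟩

lemma radius_nonneg {r : ℝ} (hr : 0 < r) (T : A → ℕ+) (a : A) : 0 ≤ P.radius r T a := by
  have h1 : 0 ≤ Real.log (Fintype.card A) := Real.log_natCast_nonneg _
  have h2 : 0 ≤ Real.log ((T a : ℝ) + 1) := Real.log_nonneg (by simp)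
  unfold radius
  positivity

/-! ### Feasibility of the robust rule -/

lemma exp_radius (P : CombProblem A) (r : ℝ) (T : A → ℕ+) (a : A) :
    ((T a : ℝ) + 1) ^ (P.supp a).card * Real.exp (-(T a * P.radius r T a))
      = (Fintype.card A : ℝ)⁻¹ * Real.exp (-(Tmin T * r)) := by
  have hT : (0 : ℝ) < T a := by exact_mod_cast (T a).pos
  have hA : (0 : ℝ) < Fintype.card A := by exact_mod_cast Fintype.card_pos
  have h1 : (0 : ℝ) < (T a : ℝ) + 1 := by positivity
  have : (T a : ℝ) * P.radius r T a = Real.log (Fintype.card A)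
      + (P.supp a).card * Real.log ((T a : ℝ) + 1) + Tmin T * r := by
    unfold radius; field_simp
  rw [this, neg_add, neg_add, Real.exp_add, Real.exp_add, Real.exp_neg (Real.log _),
    Real.exp_log hA, Real.exp_neg (_ * Real.log _), Real.exp_nat_mul, Real.exp_log h1]
  field_simp

lemma IsDataLaw.disappointment_robust_le (hL : P.IsDataLaw L) (r : ℝ) (T : A → ℕ+)
    (x : P.Prescriptor) (Q : P.Dist) :
    P.disappointment L (P.robustPredictor (P.radius r T)) x Q T
      ≤ ENNReal.ofReal (Real.exp (-(Tmin T * r))) := by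
  have hA : (Fintype.card A : ℝ) ≠ 0 := by exact_mod_cast Fintype.card_ne_zero
  calc _ ≤ L Q T (⋃ a, {C | (P.radius r T a : EReal)
            < relEntropy (P.empirical C a) (P.marginals Q a)}) := by
        refine measure_mono fun C hC => ?_
        by_contra hcon
        simp only [Set.mem_iUnion, Set.mem_ofPred_eq, not_exists, not_lt] at hcon
        exact (P.loss_le_robustPredictor hcon _).not_gt hC
    _ ≤ ∑ a, L Q T {C | (P.radius r T a : EReal)
            < relEntropy (P.empirical C a) (P.marginals Q a)} := measure_iUnion_fintype_le _ _
    _ ≤ ∑ _a : A, ENNReal.ofReal ((Fintype.card A : ℝ)⁻¹ * Real.exp (-(Tmin T * r))) :=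
        Finset.sum_le_sum fun a _ => by
          rw [← exp_radius P r T a]
          exact hL.relEntropy_gt_le Q T a _
    _ = _ := by
        rw [← ENNReal.ofReal_sum_of_nonneg fun _ _ => by positivity]
        simp [hA]

lemma IsDataLaw.feasible_robust (hL : P.IsDataLaw L) (r : ℝ) {x : (A → ℕ+) → P.Prescriptor}
    (hx : ∀ T, P.IsPrescription (P.robustPredictor (P.radius r T)) (x T)) :
    P.Feasible L r (fun T => P.robustPredictor (P.radius r T)) x := by
  refine ⟨hx, fun Q => limsup_le_of_le (by isBoundedDefault) (Eventually.of_forall fun T => ?_)⟩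
  have hT : (0 : ℝ) < Tmin T := by exact_mod_cast (Tmin T).pos
  calc _ ≤ ((1 / (Tmin T : ℝ) : ℝ) : EReal)
          * ENNReal.log (ENNReal.ofReal (Real.exp (-(Tmin T * r)))) := by
        refine mul_le_mul_of_nonneg_left ?_ (by exact_mod_cast (by positivity))
        exact ENNReal.log_monotone (hL.disappointment_robust_le r T (x T) Q)
    _ = _ := by
        rw [ENNReal.log_ofReal_of_pos (Real.exp_pos _), Real.log_exp, ← EReal.coe_mul]
        congr 1
        field_simp

end CombProblem

theorem theorem3 {A : Type*} [Fintype A] [Nonempty A] (P : CombProblem A)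
    (L : P.Dist → (T : A → ℕ+) → MeasureTheory.Measure (P.Data T)) (hL : P.IsDataLaw L)
    (r : ℝ) (hr : 0 < r)
    (x : (A → ℕ+) → P.Prescriptor)
    (hx : ∀ T, P.IsPrescription (P.robustPredictor (P.radius r T)) (x T)) :
    P.WeaklyOptimal L r (fun T => P.robustPredictor (P.radius r T)) x ∧
    ∀ (g : P.Predictor) (y : P.Prescriptor), P.Feasible L r (fun _ => g) (fun _ => y) →
      ∀ T, ¬ P.LessConservative g y (P.robustPredictor (P.radius r T)) (x T) := by
  refine ⟨⟨hL.feasible_robust r hx, ?_⟩, ?_⟩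
  · rintro ⟨g, y, hg, hfreq⟩
    obtain ⟨T, hT, hle⟩ := (hfreq.and_eventually (hg.eventually_loss_maxDist_le hL hr)).exists
    exact CombProblem.not_lessConservative_robust (CombProblem.radius_nonneg hr T) (hx T) hle hT
  · intro g y hg T
    have := CombProblem.largeSamples_neBot (A := A)
    obtain ⟨_, hle⟩ := (hg.eventually_loss_maxDist_le hL hr).exists
    exact CombProblem.not_lessConservative_robust (CombProblem.radius_nonneg hr T) (hx T) hle
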